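/- Let $\Lambda=\{m(1,0)+k(\tfrac12,\tfrac{\sqrt7}{2}) : m,k\in\mathbb Z\}\subset\mathbb R^2$, i.e. the ring of integers of $\mathbb Q(\sqrt{-7})$ embedded in the Euclidean plane. The distances determined by a set of points are the Euclidean distances between two distinct points of the set. (1) Every $4$ distinct points of $\Lambda$ determine at least $3$ distinct distances. (2) For every integer $n\ge 0$ there is a set $P_n$ consisting of $n$ points of $\Lambda$ nearest to the origin, that is, $P_n\subset\Lambda$, $|P_n|=n$ and $\|p\|\le\|q\|$ for all $p\in P_n$ and $q\in\Lambda\setminus P_n$. For every such $P_n$ (however ties are broken), every $4$ distinct points of $P_n$ determine at least $3$ distinct distances. (3) There is an absolute constant $C>0$ such that for every $n\ge 2$ and every such $P_n$, the number of distinct distances determined by $P_n$ is at most $C\,n/\sqrt{\log n}$. In particular, for every $n \geq 2$ there is a set of $n$ points in $\mathbb R^2$ of which every $4$ points determine at least $3$ distances, while the total number of distinct distances is $O(n/\sqrt{\log n})$. -/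

import Mathlib

/-- The Euclidean plane. -/
abbrev Plane : Type := EuclideanSpace ℝ (Fin 2)

/-- The ring of integers of `ℚ(√-7)`, embedded in the plane: the lattice of all points
`m (1, 0) + k (1/2, √7/2)` with integers `m`, `k`. -/
def latticeSeven : Set Plane :=
  {u | ∃ m k : ℤ, u = (m : ℝ) • !₂[(1 : ℝ), 0] + (k : ℝ) • !₂[(1 / 2 : ℝ), Real.sqrt 7 / 2]}

/-- The distances determined by `S`: those between two distinct points of `S`. -/
def distances (S : Set Plane) : Set ℝ :=
  {d | ∃ x ∈ S, ∃ y ∈ S, x ≠ y ∧ dist x y = d}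

/-- Every four distinct points of `S` determine at least three distinct distances. -/
def FourPointsThreeDistances (S : Set Plane) : Prop :=
  ∀ T : Finset Plane, (T : Set Plane) ⊆ S → T.card = 4 →
    3 ≤ (distances (T : Set Plane)).ncard

/-- `P` consists of `n` points of the lattice nearest to the origin, ties being broken
arbitrarily. -/
def IsNearestLatticePoints (n : ℕ) (P : Finset Plane) : Prop :=
  (P : Set Plane) ⊆ latticeSeven ∧ P.card = n ∧
    ∀ p ∈ P, ∀ q ∈ latticeSeven, q ∉ P → ‖p‖ ≤ ‖q‖

/-! Squared distances in the lattice are values of the integral form `normForm`. Colour the six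
pairs of four points by two distances. Either some triangle is monochromatic, hence equilateral, or
one colour forms a 4-cycle (a square), or both colours form paths (four vertices of a regular
pentagon). Gram determinants of lattice vectors then force 21, 7 or 5 to be a perfect square:
`not_equilateral`, `not_square`, `not_pentagon`.

A nearest `n`-point set has squared norms `O(n)`, so its distances are counted by the values of the
form up to `16 * n`. Such a value is `d ^ 2 * w`, where `w` has no prime factor inert in `ℚ(√-7)`.
For the `w ≤ x`, writing `log` as a divisor sum of the von Mangoldt function and using Chebyshev's
bound gives `log x * count ≪ x * ∑ 1 / w` (`log_mul_card_noInert_le`). The reciprocal sum is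
`O(√(log x))`, because its square is dominated by `∑ (1 * χ)(n) / n`, where `χ` is the quadratic
character modulo 7 and `∑ χ(m) / m` is bounded (`splitSum_sq_le`). Summing over `d` gives
`exists_card_normValues_le`. -/

/-! ### The lattice and its norm form -/

/-- The lattice point with coordinates `m`, `k`. -/
noncomputable def latticePoint (m k : ℤ) : Plane :=
  (m : ℝ) • !₂[(1 : ℝ), 0] + (k : ℝ) • !₂[(1 / 2 : ℝ), Real.sqrt 7 / 2]

/-- The norm form of `ℤ[(1 + √-7) / 2]`. -/
def normForm (m k : ℤ) : ℤ := m ^ 2 + m * k + 2 * k ^ 2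

/-- Twice the bilinear form that belongs to `normForm`. -/
def polarForm (m k m' k' : ℤ) : ℤ := 2 * m * m' + m * k' + m' * k + 4 * k * k'

lemma mem_latticeSeven {u : Plane} : u ∈ latticeSeven ↔ ∃ m k : ℤ, u = latticePoint m k := Iff.rfl

lemma latticePoint_mem (m k : ℤ) : latticePoint m k ∈ latticeSeven := ⟨m, k, rfl⟩

lemma latticePoint_sub (m k m' k' : ℤ) :
    latticePoint m k - latticePoint m' k' = latticePoint (m - m') (k - k') := by
  simp only [latticePoint, Int.cast_sub, sub_smul]
  abel

lemma norm_latticePoint_sq (m k : ℤ) : ‖latticePoint m k‖ ^ 2 = normForm m k := by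
  have h7 : Real.sqrt 7 ^ 2 = 7 := Real.sq_sqrt (by norm_num)
  rw [EuclideanSpace.norm_sq_eq]
  simp [latticePoint, normForm, Fin.sum_univ_two]
  linear_combination (k : ℝ) ^ 2 / 4 * h7

lemma dist_latticePoint_sq (m k m' k' : ℤ) :
    dist (latticePoint m k) (latticePoint m' k') ^ 2 = normForm (m - m') (k - k') := by
  rw [dist_eq_norm, latticePoint_sub, norm_latticePoint_sq]

lemma normForm_nonneg (m k : ℤ) : 0 ≤ normForm m k := by
  unfold normForm
  nlinarith [sq_nonneg (2 * m + k), sq_nonneg k]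

lemma normForm_pos_of_ne {m k m' k' : ℤ} (h : latticePoint m k ≠ latticePoint m' k') :
    0 < normForm (m - m') (k - k') := by
  have h1 : (0 : ℝ) < dist (latticePoint m k) (latticePoint m' k') ^ 2 := by
    have := dist_pos.mpr h
    positivity
  rw [dist_latticePoint_sq] at h1
  exact_mod_cast h1

lemma latticePoint_injective {m k m' k' : ℤ} (h : latticePoint m k = latticePoint m' k') :
    m = m' ∧ k = k' := by
  have h1 : dist (latticePoint m k) (latticePoint m' k') ^ 2 = 0 := by simp [h]
  rw [dist_latticePoint_sq] at h1
  have h2 : normForm (m - m') (k - k') = 0 := by exact_mod_cast h1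
  unfold normForm at h2
  have hk : (k - k') ^ 2 = 0 := by
    nlinarith [sq_nonneg (2 * (m - m') + (k - k')), sq_nonneg (k - k')]
  have hk' : k - k' = 0 := by simpa using hk
  rw [hk'] at h2
  have hm : m - m' = 0 := by simpa using h2
  omega

lemma polarForm_sub_sub (m₁ k₁ m₂ k₂ m₃ k₃ : ℤ) :
    polarForm (m₁ - m₂) (k₁ - k₂) (m₁ - m₃) (k₁ - k₃) =
      normForm (m₁ - m₂) (k₁ - k₂) + normForm (m₁ - m₃) (k₁ - k₃)
        - normForm (m₂ - m₃) (k₂ - k₃) := by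
  unfold polarForm normForm; ring

/-- The form has discriminant `-7`, so the area of a lattice triangle is a rational multiple of
`√7`; this is the source of the arithmetic obstructions for the triangle and the square. -/
lemma four_mul_normForm_mul_sub_polarForm_sq (m k m' k' : ℤ) :
    4 * normForm m k * normForm m' k' - polarForm m k m' k' ^ 2 = 7 * (m * k' - m' * k) ^ 2 := by
  unfold polarForm normForm; ring

/-- The Gram determinant of three vectors of the plane vanishes. -/
lemma gram_det_eq_zero (a b c d e f : ℤ) :
    2 * normForm a b * (4 * normForm c d * normForm e f - polarForm c d e f ^ 2)
      - polarForm a b c d *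
        (2 * polarForm a b c d * normForm e f - polarForm c d e f * polarForm a b e f)
      + polarForm a b e f *
        (polarForm a b c d * polarForm c d e f - 2 * normForm c d * polarForm a b e f) = 0 := by
  unfold polarForm normForm; ring

lemma exists_sq_of_sq_eq_mul_sq {x y c : ℤ} (hy : y ≠ 0) (h : x ^ 2 = c * y ^ 2) :
    ∃ z : ℤ, c = z ^ 2 := by
  have hd : y ^ 2 ∣ x ^ 2 := ⟨c, by rw [h]; ring⟩
  obtain ⟨z, rfl⟩ := (Int.pow_dvd_pow_iff two_ne_zero).mp hd
  refine ⟨z, ?_⟩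
  have : y ^ 2 * (c - z ^ 2) = 0 := by linear_combination -h
  rcases mul_eq_zero.mp this with h0 | h0
  · exact absurd (by simpa using h0) hy
  · linarith

lemma sq_ne_of_between {z c n : ℤ} (h0 : 0 ≤ n) (h1 : n ^ 2 < c) (h2 : c < (n + 1) ^ 2) :
    c ≠ z ^ 2 := by
  rintro rfl
  have h3 := abs_lt_of_sq_lt_sq h2 (by omega)
  have h4 : n < |z| := lt_of_pow_lt_pow_left₀ 2 (abs_nonneg z) (by rwa [sq_abs])
  omega

lemma normForm_neg (m k : ℤ) : normForm (-m) (-k) = normForm m k := by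
  unfold normForm; ring

/-! ### Four-point configurations with two distances -/

/-- No three lattice points form an equilateral triangle. -/
lemma not_equilateral {m₁ k₁ m₂ k₂ m₃ k₃ : ℤ} {α : ℝ}
    (hα : (0 : ℝ) < normForm (m₁ - m₂) (k₁ - k₂))
    (h₁₂ : (normForm (m₁ - m₂) (k₁ - k₂) : ℝ) = α) (h₁₃ : (normForm (m₁ - m₃) (k₁ - k₃) : ℝ) = α)
    (h₂₃ : (normForm (m₂ - m₃) (k₂ - k₃) : ℝ) = α) : False := by
  obtain ⟨A, hA⟩ : ∃ A, A = normForm (m₁ - m₂) (k₁ - k₂) := ⟨_, rfl⟩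
  have hu := hA.symm
  have hv : normForm (m₁ - m₃) (k₁ - k₃) = A := by rw [hA]; exact_mod_cast h₁₃.trans h₁₂.symm
  have hw : normForm (m₂ - m₃) (k₂ - k₃) = A := by rw [hA]; exact_mod_cast h₂₃.trans h₁₂.symm
  have hpos : A ≠ 0 := by rintro rfl; simp [hu] at hα
  have hp := polarForm_sub_sub m₁ k₁ m₂ k₂ m₃ k₃
  have hd := four_mul_normForm_mul_sub_polarForm_sq (m₁ - m₂) (k₁ - k₂) (m₁ - m₃) (k₁ - k₃)
  rw [hu, hv, hw] at hp
  rw [hp, hu, hv] at hd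
  -- With all sides equal, `hd` reads `3 * A ^ 2 = 7 * D ^ 2`, so `(7 * D) ^ 2 = 21 * A ^ 2`.
  obtain ⟨z, hz⟩ := exists_sq_of_sq_eq_mul_sq (c := 21) hpos
    (x := 7 * ((m₁ - m₂) * (k₁ - k₃) - (m₁ - m₃) * (k₁ - k₂))) (by linear_combination -7 * hd)
  exact sq_ne_of_between (n := 4) (by norm_num) (by norm_num) (by norm_num) hz

/-- No four lattice points form a square. -/
lemma not_square {m₁ k₁ m₂ k₂ m₃ k₃ m₄ k₄ : ℤ} {α β : ℝ}
    (hα : (0 : ℝ) < normForm (m₁ - m₂) (k₁ - k₂))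
    (hβ : (0 : ℝ) < normForm (m₁ - m₃) (k₁ - k₃))
    (h₁₂ : (normForm (m₁ - m₂) (k₁ - k₂) : ℝ) = α) (h₂₃ : (normForm (m₂ - m₃) (k₂ - k₃) : ℝ) = α)
    (h₃₄ : (normForm (m₃ - m₄) (k₃ - k₄) : ℝ) = α) (h₁₄ : (normForm (m₁ - m₄) (k₁ - k₄) : ℝ) = α)
    (h₁₃ : (normForm (m₁ - m₃) (k₁ - k₃) : ℝ) = β) (h₂₄ : (normForm (m₂ - m₄) (k₂ - k₄) : ℝ) = β) :
    False := by
  obtain ⟨A, hA⟩ : ∃ A, A = normForm (m₁ - m₂) (k₁ - k₂) := ⟨_, rfl⟩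
  obtain ⟨B, hB⟩ : ∃ B, B = normForm (m₁ - m₃) (k₁ - k₃) := ⟨_, rfl⟩
  have e₁₂ := hA.symm
  have e₁₃ := hB.symm
  have e₂₃ : normForm (m₂ - m₃) (k₂ - k₃) = A := by rw [hA]; exact_mod_cast h₂₃.trans h₁₂.symm
  have e₃₄ : normForm (m₃ - m₄) (k₃ - k₄) = A := by rw [hA]; exact_mod_cast h₃₄.trans h₁₂.symm
  have e₁₄ : normForm (m₁ - m₄) (k₁ - k₄) = A := by rw [hA]; exact_mod_cast h₁₄.trans h₁₂.symm
  have e₂₄ : normForm (m₂ - m₄) (k₂ - k₄) = B := by rw [hB]; exact_mod_cast h₂₄.trans h₁₃.symm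
  have hApos : A ≠ 0 := by rintro rfl; simp [e₁₂] at hα
  have hBpos : B ≠ 0 := by rintro rfl; simp [e₁₃] at hβ
  have p₂₃ := polarForm_sub_sub m₁ k₁ m₂ k₂ m₃ k₃
  have p₂₄ := polarForm_sub_sub m₁ k₁ m₂ k₂ m₄ k₄
  have p₃₄ := polarForm_sub_sub m₁ k₁ m₃ k₃ m₄ k₄
  rw [e₁₂, e₁₃, e₂₃] at p₂₃
  rw [e₁₂, e₁₄, e₂₄] at p₂₄
  rw [e₁₃, e₁₄, e₃₄] at p₃₄
  have hg := gram_det_eq_zero (m₁ - m₂) (k₁ - k₂) (m₁ - m₃) (k₁ - k₃) (m₁ - m₄) (k₁ - k₄)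
  have hd := four_mul_normForm_mul_sub_polarForm_sq (m₁ - m₂) (k₁ - k₂) (m₁ - m₄) (k₁ - k₄)
  rw [p₂₃, p₂₄, p₃₄, e₁₂, e₁₃, e₁₄] at hg
  rw [p₂₄, e₁₂, e₁₄] at hd
  -- Planarity: the Gram determinant leaves only `B = 2 * A`, which makes adjacent sides orthogonal.
  have hAB : B ^ 2 * (2 * A - B) = 0 := by linarith [hg]
  have hAB' : B = 2 * A := by
    rcases mul_eq_zero.mp hAB with h | h
    · exact absurd (by simpa using h) hBpos
    · omega
  subst hAB'
  obtain ⟨z, hz⟩ := exists_sq_of_sq_eq_mul_sq (c := 7) (y := 2 * A) (by omega)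
    (x := 7 * ((m₁ - m₂) * (k₁ - k₄) - (m₁ - m₄) * (k₁ - k₂))) (by linear_combination -7 * hd)
  exact sq_ne_of_between (n := 2) (by norm_num) (by norm_num) (by norm_num) hz

/-- No four lattice points are vertices of a regular pentagon. -/
lemma not_pentagon {m₁ k₁ m₂ k₂ m₃ k₃ m₄ k₄ : ℤ} {α β : ℝ}
    (hα : (0 : ℝ) < normForm (m₁ - m₂) (k₁ - k₂))
    (hβ : (0 : ℝ) < normForm (m₁ - m₃) (k₁ - k₃))
    (h₁₂ : (normForm (m₁ - m₂) (k₁ - k₂) : ℝ) = α) (h₂₃ : (normForm (m₂ - m₃) (k₂ - k₃) : ℝ) = α)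
    (h₃₄ : (normForm (m₃ - m₄) (k₃ - k₄) : ℝ) = α) (h₁₄ : (normForm (m₁ - m₄) (k₁ - k₄) : ℝ) = β)
    (h₁₃ : (normForm (m₁ - m₃) (k₁ - k₃) : ℝ) = β) (h₂₄ : (normForm (m₂ - m₄) (k₂ - k₄) : ℝ) = β) :
    False := by
  obtain ⟨A, hA⟩ : ∃ A, A = normForm (m₁ - m₂) (k₁ - k₂) := ⟨_, rfl⟩
  obtain ⟨B, hB⟩ : ∃ B, B = normForm (m₁ - m₃) (k₁ - k₃) := ⟨_, rfl⟩
  have e₁₂ := hA.symm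
  have e₁₃ := hB.symm
  have e₂₃ : normForm (m₂ - m₃) (k₂ - k₃) = A := by rw [hA]; exact_mod_cast h₂₃.trans h₁₂.symm
  have e₃₄ : normForm (m₃ - m₄) (k₃ - k₄) = A := by rw [hA]; exact_mod_cast h₃₄.trans h₁₂.symm
  have e₁₄ : normForm (m₁ - m₄) (k₁ - k₄) = B := by rw [hB]; exact_mod_cast h₁₄.trans h₁₃.symm
  have e₂₄ : normForm (m₂ - m₄) (k₂ - k₄) = B := by rw [hB]; exact_mod_cast h₂₄.trans h₁₃.symm
  have hApos : 0 < A := by rw [e₁₂] at hα; exact_mod_cast hα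
  have hBpos : 0 < B := by rw [e₁₃] at hβ; exact_mod_cast hβ
  have p₂₃ := polarForm_sub_sub m₁ k₁ m₂ k₂ m₃ k₃
  have p₂₄ := polarForm_sub_sub m₁ k₁ m₂ k₂ m₄ k₄
  have p₃₄ := polarForm_sub_sub m₁ k₁ m₃ k₃ m₄ k₄
  rw [e₁₂, e₁₃, e₂₃] at p₂₃
  rw [e₁₂, e₁₄, e₂₄] at p₂₄
  rw [e₁₃, e₁₄, e₃₄] at p₃₄
  have hg := gram_det_eq_zero (m₁ - m₂) (k₁ - k₂) (m₁ - m₃) (k₁ - k₃) (m₁ - m₄) (k₁ - k₄)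
  rw [p₂₃, p₂₄, p₃₄, e₁₂, e₁₃, e₁₄] at hg
  -- Planarity makes `A / B` a root of `t ^ 2 - 3 * t + 1`, whose discriminant is 5.
  have hAB : (A + B) * (A ^ 2 - 3 * A * B + B ^ 2) = 0 := by linarith [hg]
  have hAB' : A ^ 2 - 3 * A * B + B ^ 2 = 0 := by
    rcases mul_eq_zero.mp hAB with h | h
    · omega
    · exact h
  obtain ⟨z, hz⟩ := exists_sq_of_sq_eq_mul_sq (c := 5) (y := B) (by omega)
    (x := 2 * A - 3 * B) (by linear_combination 4 * hAB')
  exact sq_ne_of_between (n := 2) (by norm_num) (by norm_num) (by norm_num) hz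

lemma exists_pair_of_ncard_le_two {D : Set ℝ} (hD : D.Finite) (h : D.ncard ≤ 2) :
    ∃ a b : ℝ, D ⊆ {a, b} := by
  have h' : D.ncard = 0 ∨ D.ncard = 1 ∨ D.ncard = 2 := by omega
  rcases h' with h | h | h
  · exact ⟨0, 0, by rw [(Set.ncard_eq_zero hD).mp h]; exact Set.empty_subset _⟩
  · obtain ⟨a, rfl⟩ := Set.ncard_eq_one.mp h
    exact ⟨a, a, by simp⟩
  · obtain ⟨a, b, -, rfl⟩ := Set.ncard_eq_two.mp h
    exact ⟨a, b, subset_rfl⟩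

lemma distances_finite {S : Set Plane} (hS : S.Finite) : (distances S).Finite := by
  refine ((hS.prod hS).image fun p => dist p.1 p.2).subset ?_
  rintro d ⟨x, hx, y, hy, -, rfl⟩
  exact ⟨(x, y), ⟨hx, hy⟩, rfl⟩

lemma FourPointsThreeDistances.mono {S S' : Set Plane} (h : FourPointsThreeDistances S')
    (hS : S ⊆ S') : FourPointsThreeDistances S :=
  fun T hT => h T (hT.trans hS)

lemma fourPointsThreeDistances_latticeSeven : FourPointsThreeDistances latticeSeven := by
  intro T hT hcard
  by_contra hlt
  obtain ⟨a, b, hab⟩ := exists_pair_of_ncard_le_two (distances_finite T.finite_toSet) (by omega)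
  obtain ⟨x₁, T', hx₁, rfl, hcard'⟩ := Finset.card_eq_succ.mp hcard
  obtain ⟨x₂, x₃, x₄, n₂₃, n₂₄, n₃₄, rfl⟩ := Finset.card_eq_three.mp hcard'
  simp only [Finset.mem_insert, Finset.mem_singleton, not_or] at hx₁
  obtain ⟨n₁₂, n₁₃, n₁₄⟩ := hx₁
  obtain ⟨m₁, k₁, rfl⟩ := mem_latticeSeven.mp (hT (show x₁ ∈ _ by simp))
  obtain ⟨m₂, k₂, rfl⟩ := mem_latticeSeven.mp (hT (show x₂ ∈ _ by simp))
  obtain ⟨m₃, k₃, rfl⟩ := mem_latticeSeven.mp (hT (show x₃ ∈ _ by simp))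
  obtain ⟨m₄, k₄, rfl⟩ := mem_latticeSeven.mp (hT (show x₄ ∈ _ by simp))
  have key : ∀ {m k m' k' : ℤ}, latticePoint m k ≠ latticePoint m' k' →
      latticePoint m k ∈ ({latticePoint m₁ k₁, latticePoint m₂ k₂, latticePoint m₃ k₃,
        latticePoint m₄ k₄} : Finset Plane) →
      latticePoint m' k' ∈ ({latticePoint m₁ k₁, latticePoint m₂ k₂, latticePoint m₃ k₃,
        latticePoint m₄ k₄} : Finset Plane) →
      (0 : ℝ) < normForm (m - m') (k - k') ∧ (0 : ℝ) < normForm (m' - m) (k' - k) ∧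
      ((normForm (m - m') (k - k') : ℝ) = a ^ 2 ∧ (normForm (m' - m) (k' - k) : ℝ) = a ^ 2 ∨
        (normForm (m - m') (k - k') : ℝ) = b ^ 2 ∧ (normForm (m' - m) (k' - k) : ℝ) = b ^ 2) := by
    intro m k m' k' hne h h'
    have hpos : (0 : ℝ) < normForm (m - m') (k - k') := by exact_mod_cast normForm_pos_of_ne hne
    rw [← neg_sub m m', ← neg_sub k k', normForm_neg]
    refine ⟨hpos, hpos, ?_⟩
    rw [← dist_latticePoint_sq]
    rcases hab ⟨_, h, _, h', hne, rfl⟩ with e | e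
    · exact Or.inl (by simp [e])
    · exact Or.inr (by simp [Set.mem_singleton_iff.mp e])
  obtain ⟨q₁₂, q₂₁, c₁₂⟩ := key n₁₂ (by simp) (by simp)
  obtain ⟨q₁₃, q₃₁, c₁₃⟩ := key n₁₃ (by simp) (by simp)
  obtain ⟨q₁₄, q₄₁, c₁₄⟩ := key n₁₄ (by simp) (by simp)
  obtain ⟨q₂₃, q₃₂, c₂₃⟩ := key n₂₃ (by simp) (by simp)
  obtain ⟨q₂₄, q₄₂, c₂₄⟩ := key n₂₄ (by simp) (by simp)
  obtain ⟨q₃₄, q₄₃, c₃₄⟩ := key n₃₄ (by simp) (by simp)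
  clear key hab hT hcard hcard' hlt n₁₂ n₁₃ n₁₄ n₂₃ n₂₄ n₃₄
  -- Of the 64 colourings, 46 have a monochromatic triangle, 6 are a 4-cycle with its diagonals and
  -- 12 are a pair of complementary paths. Each square or pentagon call covers both ways of
  -- assigning the colours.
  rcases c₁₂ with ⟨c₁₂, c₂₁⟩ | ⟨c₁₂, c₂₁⟩ <;>
  rcases c₁₃ with ⟨c₁₃, c₃₁⟩ | ⟨c₁₃, c₃₁⟩ <;>
  rcases c₁₄ with ⟨c₁₄, c₄₁⟩ | ⟨c₁₄, c₄₁⟩ <;>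
  rcases c₂₃ with ⟨c₂₃, c₃₂⟩ | ⟨c₂₃, c₃₂⟩ <;>
  rcases c₂₄ with ⟨c₂₄, c₄₂⟩ | ⟨c₂₄, c₄₂⟩ <;>
  rcases c₃₄ with ⟨c₃₄, c₄₃⟩ | ⟨c₃₄, c₄₃⟩ <;>
  first
  | exact not_equilateral q₁₂ c₁₂ c₁₃ c₂₃
  | exact not_equilateral q₁₂ c₁₂ c₁₄ c₂₄
  | exact not_equilateral q₁₃ c₁₃ c₁₄ c₃₄
  | exact not_equilateral q₂₃ c₂₃ c₂₄ c₃₄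
  | exact not_square q₁₂ q₁₃ c₁₂ c₂₃ c₃₄ c₁₄ c₁₃ c₂₄
  | exact not_square q₁₂ q₁₄ c₁₂ c₂₄ c₄₃ c₁₃ c₁₄ c₂₃
  | exact not_square q₁₃ q₁₂ c₁₃ c₃₂ c₂₄ c₁₄ c₁₂ c₃₄
  | exact not_pentagon q₁₂ q₁₃ c₁₂ c₂₃ c₃₄ c₁₄ c₁₃ c₂₄
  | exact not_pentagon q₁₂ q₁₄ c₁₂ c₂₄ c₄₃ c₁₃ c₁₄ c₂₃
  | exact not_pentagon q₁₃ q₁₂ c₁₃ c₃₂ c₂₄ c₁₄ c₁₂ c₃₄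
  | exact not_pentagon q₁₃ q₁₄ c₁₃ c₃₄ c₄₂ c₁₂ c₁₄ c₃₂
  | exact not_pentagon q₁₄ q₁₂ c₁₄ c₄₂ c₂₃ c₁₃ c₁₂ c₄₃
  | exact not_pentagon q₁₄ q₁₃ c₁₄ c₄₃ c₃₂ c₁₂ c₁₃ c₄₂

/-! ### Nearest-point sets and their distances -/

lemma latticeSeven_infinite : latticeSeven.Infinite := by
  refine Set.infinite_of_injective_forall_mem (f := fun n : ℕ => latticePoint n 0) ?_
    fun n => latticePoint_mem _ _
  intro a b h
  exact_mod_cast (latticePoint_injective h).1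

lemma exists_isNearestLatticePoints (n : ℕ) : ∃ P : Finset Plane, IsNearestLatticePoints n P := by
  classical
  induction n with
  | zero => exact ⟨∅, by simp [IsNearestLatticePoints]⟩
  | succ n ih =>
    obtain ⟨P, hP, hcard, hmin⟩ := ih
    -- Squared norms are natural numbers, so a nearest remaining point exists by well-ordering and
    -- can be adjoined.
    have hex : ∃ v : ℕ, ∃ m k : ℤ, latticePoint m k ∉ P ∧ normForm m k = v := by
      obtain ⟨q, hq, hqP⟩ := latticeSeven_infinite.exists_notMem_finset P
      obtain ⟨m, k, rfl⟩ := mem_latticeSeven.mp hq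
      exact ⟨(normForm m k).toNat, m, k, hqP, (Int.toNat_of_nonneg (normForm_nonneg m k)).symm⟩
    obtain ⟨m, k, hmk, hv⟩ := Nat.find_spec hex
    refine ⟨insert (latticePoint m k) P, ?_, by rw [Finset.card_insert_of_notMem hmk, hcard], ?_⟩
    · intro x hx
      rcases Finset.mem_insert.mp (Finset.mem_coe.mp hx) with rfl | hx
      · exact latticePoint_mem m k
      · exact hP hx
    · intro p hp q hq hqP
      rw [Finset.mem_insert, not_or] at hqP
      rcases Finset.mem_insert.mp hp with rfl | hp
      · obtain ⟨m', k', rfl⟩ := mem_latticeSeven.mp hq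
        have hle := Nat.find_min' hex ⟨m', k', hqP.2,
          (Int.toNat_of_nonneg (normForm_nonneg m' k')).symm⟩
        have hle' : normForm m k ≤ normForm m' k' := by
          have := normForm_nonneg m' k'
          omega
        refine (sq_le_sq₀ (norm_nonneg _) (norm_nonneg _)).mp ?_
        rw [norm_latticePoint_sq, norm_latticePoint_sq]
        exact_mod_cast hle'
      · exact hmin p hp q hq hqP.2

/-- The points of a nearest `n`-point set have squared norm at most `4 n`. -/
lemma IsNearestLatticePoints.normForm_le {n : ℕ} {P : Finset Plane}
    (h : IsNearestLatticePoints n P) {m k : ℤ} (hp : latticePoint m k ∈ P) :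
    normForm m k ≤ 4 * n := by
  classical
  obtain ⟨-, hcard, hmin⟩ := h
  by_contra! hlt
  -- All points of this box have squared norm at most `4 * n`, so a farther point of `P` forces the
  -- whole box into `P`; but the box has `(Nat.sqrt n + 1) ^ 2 > n` points.
  have hbox : ∀ a b : ℕ, a ≤ Nat.sqrt n → b ≤ Nat.sqrt n → latticePoint a b ∈ P := by
    intro a b ha hb
    by_contra hab
    have hle := hmin _ hp _ (latticePoint_mem a b) hab
    have hle' : normForm m k ≤ normForm a b := by
      have := pow_le_pow_left₀ (norm_nonneg _) hle 2
      rw [norm_latticePoint_sq, norm_latticePoint_sq] at this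
      exact_mod_cast this
    have h1 : a * a ≤ n := (Nat.mul_le_mul ha ha).trans (Nat.sqrt_le n)
    have h2 : a * b ≤ n := (Nat.mul_le_mul ha hb).trans (Nat.sqrt_le n)
    have h3 : b * b ≤ n := (Nat.mul_le_mul hb hb).trans (Nat.sqrt_le n)
    have h4 : normForm a b ≤ 4 * n := by
      unfold normForm
      zify at h1 h2 h3
      nlinarith
    omega
  have hsub : ((Finset.range (Nat.sqrt n + 1) ×ˢ Finset.range (Nat.sqrt n + 1)).image
      fun x => latticePoint (x.1 : ℕ) (x.2 : ℕ)) ⊆ P := by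
    intro x hx
    obtain ⟨⟨a, b⟩, hab, rfl⟩ := Finset.mem_image.mp hx
    simp only [Finset.mem_product, Finset.mem_range] at hab
    exact hbox a b (by omega) (by omega)
  have hle := Finset.card_le_card hsub
  rw [Finset.card_image_of_injective, Finset.card_product, Finset.card_range, hcard] at hle
  · exact absurd (Nat.lt_succ_sqrt n) (not_lt.mpr hle)
  · rintro ⟨a, b⟩ ⟨c, d⟩ hab
    have := latticePoint_injective hab
    simp only [Nat.cast_inj] at this
    exact Prod.ext this.1 this.2

open Classical in
/-- The positive integers up to `N` that are values of the norm form. -/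
noncomputable def normValues (N : ℕ) : Finset ℕ :=
  (Finset.Icc 1 N).filter fun v => ∃ m k : ℤ, normForm m k = v

lemma mem_normValues {N v : ℕ} :
    v ∈ normValues N ↔ (1 ≤ v ∧ v ≤ N) ∧ ∃ m k : ℤ, normForm m k = v := by
  simp [normValues]

lemma IsNearestLatticePoints.ncard_distances_le {n : ℕ} {P : Finset Plane}
    (h : IsNearestLatticePoints n P) :
    (distances (P : Set Plane)).ncard ≤ (normValues (16 * n)).card := by
  classical
  have hsub : distances (P : Set Plane) ⊆
      ((normValues (16 * n)).image fun v : ℕ => Real.sqrt v : Finset ℝ) := by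
    rintro d ⟨x, hx, y, hy, hne, rfl⟩
    obtain ⟨m, k, rfl⟩ := mem_latticeSeven.mp (h.1 hx)
    obtain ⟨m', k', rfl⟩ := mem_latticeSeven.mp (h.1 hy)
    have h1 := h.normForm_le hx
    have h2 := h.normForm_le hy
    have hpos := normForm_pos_of_ne hne
    -- Parallelogram law: `16 = 2 * 4 + 2 * 4`.
    have hle : normForm (m - m') (k - k') ≤ 16 * n := by
      have h3 := normForm_nonneg (m + m') (k + k')
      have h4 : normForm (m - m') (k - k') + normForm (m + m') (k + k') =
        2 * normForm m k + 2 * normForm m' k' := by unfold normForm; ring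
      omega
    have hcast : ((normForm (m - m') (k - k')).toNat : ℤ) = normForm (m - m') (k - k') :=
      Int.toNat_of_nonneg hpos.le
    rw [Finset.coe_image]
    refine ⟨(normForm (m - m') (k - k')).toNat, ?_, ?_⟩
    · exact mem_normValues.mpr ⟨by omega, _, _, hcast.symm⟩
    · have : (((normForm (m - m') (k - k')).toNat : ℕ) : ℝ) =
          dist (latticePoint m k) (latticePoint m' k') ^ 2 := by
        rw [dist_latticePoint_sq]; exact_mod_cast hcast
      simp only [this]
      exact Real.sqrt_sq dist_nonneg
  refine (Set.ncard_le_ncard hsub (Finset.finite_toSet _)).trans ?_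
  rw [Set.ncard_coe_finset]
  exact Finset.card_image_le

section

open Finset

/-! ### The quadratic character modulo 7 -/

instance fact_prime_seven : Fact (Nat.Prime 7) := ⟨by norm_num⟩

/-- The quadratic character modulo `7`, as a function on the natural numbers. -/
def chiSeven (n : ℕ) : ℤ := quadraticChar (ZMod 7) (n : ZMod 7)

lemma chiSeven_mul (m n : ℕ) : chiSeven (m * n) = chiSeven m * chiSeven n := by
  rw [chiSeven, Nat.cast_mul, map_mul]; rfl

lemma chiSeven_one : chiSeven 1 = 1 := by simp [chiSeven]

lemma chiSeven_trichotomy (n : ℕ) : chiSeven n = 0 ∨ chiSeven n = 1 ∨ chiSeven n = -1 :=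
  quadraticChar_isQuadratic (ZMod 7) _

lemma chiSeven_eq_zero {n : ℕ} (h : chiSeven n = 0) : 7 ∣ n := by
  rw [chiSeven, quadraticChar_eq_zero_iff] at h
  exact (ZMod.natCast_eq_zero_iff n 7).mp h

/-- The partial sums of `chiSeven`, by residue class. -/
def chiSevenPartialSum (a : ZMod 7) : ℤ :=
  if a = 0 ∨ a = 6 then 0 else if a = 2 ∨ a = 4 then 2 else 1

lemma sum_chiSeven (n : ℕ) : ∑ d ∈ Ioc 0 n, chiSeven d = chiSevenPartialSum n := by
  have step : ∀ a : ZMod 7,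
      chiSevenPartialSum (a + 1) = chiSevenPartialSum a + quadraticChar (ZMod 7) (a + 1) := by
    decide
  induction n with
  | zero => simp [chiSevenPartialSum]
  | succ n ih => rw [sum_Ioc_succ_top (by omega), ih, Nat.cast_succ, step, chiSeven, Nat.cast_succ]

lemma chiSevenPartialSum_le_two (a : ZMod 7) : chiSevenPartialSum a ≤ 2 := by
  revert a; decide

lemma sum_chiSeven_div_le_two (n : ℕ) : ∑ d ∈ Ioc 0 n, (chiSeven d : ℝ) / d ≤ 2 := by
  -- Abel summation in inductive form: the subtracted term carries the gap between the partial sum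
  -- of the character and its maximum 2.
  have key : ∑ d ∈ Ioc 0 n, (chiSeven d : ℝ) / d
      ≤ 2 - (2 - ∑ d ∈ Ioc 0 n, (chiSeven d : ℝ)) / (n + 1) := by
    induction n with
    | zero => simp
    | succ n ih =>
      have hS : ∑ d ∈ Ioc 0 (n + 1), (chiSeven d : ℝ) ≤ 2 := by
        have := (sum_chiSeven (n + 1)).trans_le (chiSevenPartialSum_le_two _)
        exact_mod_cast this
      have hle : (2 - ∑ d ∈ Ioc 0 (n + 1), (chiSeven d : ℝ)) / ((n + 1 : ℕ) + 1)
          ≤ (2 - ∑ d ∈ Ioc 0 (n + 1), (chiSeven d : ℝ)) / (n + 1) := by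
        refine div_le_div_of_nonneg_left (by linarith) (by positivity) ?_
        push_cast; linarith
      refine le_trans ?_ (sub_le_sub_left hle 2)
      rw [sum_Ioc_succ_top (by omega), sum_Ioc_succ_top (by omega)]
      calc _ ≤ 2 - (2 - ∑ d ∈ Ioc 0 n, (chiSeven d : ℝ)) / (n + 1)
            + (chiSeven (n + 1) : ℝ) / (n + 1 : ℕ) := by gcongr
        _ = _ := by push_cast; ring
  have hS : ∑ d ∈ Ioc 0 n, (chiSeven d : ℝ) ≤ 2 := by
    have := (sum_chiSeven n).trans_le (chiSevenPartialSum_le_two _)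
    exact_mod_cast this
  have : 0 ≤ (2 - ∑ d ∈ Ioc 0 n, (chiSeven d : ℝ)) / (n + 1) :=
    div_nonneg (by linarith) (by positivity)
  linarith

/-- The sum is multiplicative, and on a prime power it is `1 + χ(p) + ... + χ(p) ^ k ≥ 0` as `χ`
takes only the values 0, 1, -1. Mathlib has this for complex characters, hence the passage to `ℂ`.
-/
lemma sum_divisors_chiSeven_nonneg (n : ℕ) : 0 ≤ ∑ d ∈ n.divisors, chiSeven d := by
  have hχ : ((quadraticChar (ZMod 7)).ringHomComp (Int.castRingHom ℂ)) ^ 2 = 1 :=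
    MulChar.isQuadratic_iff_sq_eq_one.mp ((quadraticChar_isQuadratic (ZMod 7)).comp _)
  have h := DirichletCharacter.zetaMul_nonneg
    (χ := (quadraticChar (ZMod 7)).ringHomComp (Int.castRingHom ℂ)) hχ n
  rw [DirichletCharacter.zetaMul, ArithmeticFunction.coe_zeta_mul_apply] at h
  have heq : ∑ d ∈ n.divisors, toArithmeticFunction
      (fun k => (quadraticChar (ZMod 7)).ringHomComp (Int.castRingHom ℂ) k) d
      = ((∑ d ∈ n.divisors, chiSeven d : ℤ) : ℂ) := by
    rw [Int.cast_sum]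
    refine sum_congr rfl fun d hd => ?_
    have hd0 : d ≠ 0 := (Nat.pos_of_mem_divisors hd).ne'
    simp [toArithmeticFunction, hd0, chiSeven]
  rw [heq] at h
  have h' := (Complex.le_def.mp h).1
  rw [Complex.intCast_re, Complex.zero_re] at h'
  exact_mod_cast h'

/-! ### Numbers without inert divisors -/

/-- All divisors of `n` have character value `1`. -/
def IsSplitNumber (n : ℕ) : Prop := n ≠ 0 ∧ ∀ d, d ∣ n → chiSeven d = 1

/-- No divisor of `n` has character value `-1`. -/
def HasNoInertDivisor (n : ℕ) : Prop := n ≠ 0 ∧ ∀ d, d ∣ n → chiSeven d ≠ -1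

lemma IsSplitNumber.mul {m n : ℕ} (hm : IsSplitNumber m) (hn : IsSplitNumber n) :
    IsSplitNumber (m * n) := by
  refine ⟨mul_ne_zero hm.1 hn.1, fun d hd => ?_⟩
  obtain ⟨a, b, ha, hb, rfl⟩ := exists_dvd_and_dvd_of_dvd_mul hd
  rw [chiSeven_mul, hm.2 a ha, hn.2 b hb, one_mul]

lemma HasNoInertDivisor.of_dvd {m n : ℕ} (hn : HasNoInertDivisor n) (h : m ∣ n) :
    HasNoInertDivisor m :=
  ⟨ne_zero_of_dvd_ne_zero hn.1 h, fun d hd => hn.2 d (hd.trans h)⟩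

lemma HasNoInertDivisor.isSplitNumber {n : ℕ} (hn : HasNoInertDivisor n) (h : ¬ 7 ∣ n) :
    IsSplitNumber n := by
  refine ⟨hn.1, fun d hd => ?_⟩
  rcases chiSeven_trichotomy d with h0 | h1 | h2
  · exact absurd ((chiSeven_eq_zero h0).trans hd) h
  · exact h1
  · exact absurd h2 (hn.2 d hd)

lemma hasNoInertDivisor_of_primes {n : ℕ} (hn : n ≠ 0)
    (h : ∀ p, p.Prime → p ∣ n → chiSeven p ≠ -1) : HasNoInertDivisor n := by
  refine ⟨hn, fun d hd => ?_⟩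
  suffices chiSeven d = 0 ∨ chiSeven d = 1 by rcases this with h | h <;> rw [h] <;> decide
  induction d using Nat.recOnMul with
  | zero => exact absurd (zero_dvd_iff.mp hd) hn
  | one => exact Or.inr chiSeven_one
  | prime p hp =>
    rcases chiSeven_trichotomy p with h0 | h1 | h2
    · exact Or.inl h0
    · exact Or.inr h1
    · exact absurd h2 (h p hp hd)
  | mul a b ha hb =>
    rw [chiSeven_mul]
    rcases ha ((dvd_mul_right a b).trans hd) with h | h <;>
      rcases hb ((dvd_mul_left b a).trans hd) with h' | h' <;> simp [h, h']

open Classical in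
/-- The sum of the reciprocals of the split numbers up to `N`. -/
noncomputable def splitSum (N : ℕ) : ℝ := ∑ n ∈ Ioc 0 N with IsSplitNumber n, 1 / (n : ℝ)

open Classical in
/-- The numbers up to `N` without inert divisor. -/
noncomputable def noInert (N : ℕ) : Finset ℕ := (Ioc 0 N).filter HasNoInertDivisor

/-- The sum of the reciprocals of the numbers up to `N` without inert divisor. -/
noncomputable def noInertSum (N : ℕ) : ℝ := ∑ n ∈ noInert N, 1 / (n : ℝ)

lemma mem_noInert {N n : ℕ} : n ∈ noInert N ↔ (0 < n ∧ n ≤ N) ∧ HasNoInertDivisor n := by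
  simp [noInert]

lemma noInertSum_nonneg (N : ℕ) : 0 ≤ noInertSum N := sum_nonneg fun _ _ => by positivity

lemma noInertSum_mono {M N : ℕ} (h : M ≤ N) : noInertSum M ≤ noInertSum N := by
  refine sum_le_sum_of_subset_of_nonneg (fun n hn => ?_) fun _ _ _ => by positivity
  rw [mem_noInert] at hn ⊢
  exact ⟨⟨hn.1.1, hn.1.2.trans h⟩, hn.2⟩

lemma card_noInert_le (N : ℕ) : (noInert N).card ≤ N := by
  classical
  exact (card_filter_le _ _).trans (by simp)

lemma sum_one_div_le_one_add_log (N : ℕ) : ∑ n ∈ Ioc 0 N, 1 / (n : ℝ) ≤ 1 + Real.log N := by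
  have h := harmonic_le_one_add_log N
  rw [harmonic_eq_sum_Icc] at h
  push_cast at h
  simpa [one_div, ← Icc_add_one_left_eq_Ioc] using h

/-- On split numbers `χ` is 1 at every divisor, so the convolution square of the split indicator
agrees there with `1 * χ`; elsewhere the former vanishes and the latter is nonnegative. Squaring the
sum thus costs only one logarithm. -/
lemma splitSum_sq_le (N : ℕ) : splitSum N ^ 2 ≤ 2 * (1 + 2 * Real.log N) := by
  classical
  let e : ArithmeticFunction ℝ := ⟨fun n => 1 / (n : ℝ), by simp⟩
  let f : ArithmeticFunction ℝ := ⟨fun n => (chiSeven n : ℝ) / n, by simp⟩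
  let g : ArithmeticFunction ℝ := ⟨fun n => if IsSplitNumber n then 1 / (n : ℝ) else 0, by simp⟩
  have he : ∀ n, e n = 1 / (n : ℝ) := fun _ => rfl
  have hf : ∀ n, f n = (chiSeven n : ℝ) / n := fun _ => rfl
  have hg : ∀ n, g n = if IsSplitNumber n then 1 / (n : ℝ) else 0 := fun _ => rfl
  have hg0 : ∀ n, 0 ≤ g n := fun n => by rw [hg]; positivity
  have hgsum : splitSum N = ∑ n ∈ Ioc 0 N, g n := by
    rw [splitSum, sum_filter]; rfl
  have hef : ∀ n, (e * f) n = (∑ d ∈ n.divisors, chiSeven d : ℤ) / (n : ℝ) := by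
    intro n
    rw [ArithmeticFunction.mul_apply, ← Nat.sum_divisorsAntidiagonal' (f := fun _ d => chiSeven d),
      Int.cast_sum, sum_div]
    refine sum_congr rfl fun x hx => ?_
    rw [he, hf, ← (Nat.mem_divisorsAntidiagonal.mp hx).1]
    push_cast
    rw [div_mul_div_comm, one_mul]
  have hle : ∀ n ∈ Ioc 0 (N * N), (g * g) n ≤ (e * f) n := by
    intro n _
    by_cases hn : IsSplitNumber n
    · rw [ArithmeticFunction.mul_apply, ArithmeticFunction.mul_apply]
      refine sum_le_sum fun x hx => ?_
      have hx' := (Nat.mem_divisorsAntidiagonal.mp hx).1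
      have h2 : chiSeven x.2 = 1 := hn.2 _ ⟨x.1, by rw [← hx', mul_comm]⟩
      rw [he, hf, h2, Int.cast_one]
      refine mul_le_mul ?_ ?_ (hg0 _) (by positivity) <;>
      · rw [hg]; split_ifs
        · exact le_rfl
        · positivity
    · rw [ArithmeticFunction.mul_apply, sum_eq_zero]
      · rw [hef]
        exact div_nonneg (by exact_mod_cast sum_divisors_chiSeven_nonneg n) (by positivity)
      · intro x hx
        rw [hg, hg]
        split_ifs with h1 h2
        · exact absurd ((Nat.mem_divisorsAntidiagonal.mp hx).1 ▸ h1.mul h2) hn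
        all_goals simp
  calc splitSum N ^ 2 = ∑ x ∈ Ioc 0 N ×ˢ Ioc 0 N, g x.1 * g x.2 := by
        rw [hgsum, sq, sum_mul_sum, sum_product]
    _ ≤ ∑ n ∈ Ioc 0 (N * N), (g * g) n := by
        rw [ArithmeticFunction.sum_Ioc_mul_eq_sum_prod_filter]
        refine sum_le_sum_of_subset_of_nonneg (fun x hx => ?_)
          fun x _ _ => mul_nonneg (hg0 _) (hg0 _)
        simp only [mem_product, mem_Ioc, mem_filter] at hx ⊢
        obtain ⟨⟨h1, h2⟩, h3, h4⟩ := hx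
        have hN : N ≤ N * N := Nat.le_mul_self N
        exact ⟨⟨⟨h1, h2.trans hN⟩, h3, h4.trans hN⟩, Nat.mul_le_mul h2 h4⟩
    _ ≤ ∑ n ∈ Ioc 0 (N * N), (e * f) n := sum_le_sum hle
    _ = ∑ n ∈ Ioc 0 (N * N), 1 / (n : ℝ) * ∑ m ∈ Ioc 0 (N * N / n), (chiSeven m : ℝ) / m :=
        ArithmeticFunction.sum_Ioc_mul_eq_sum_sum e f (N * N)
    _ ≤ ∑ n ∈ Ioc 0 (N * N), 1 / (n : ℝ) * 2 := by
        gcongr with n _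
        exact sum_chiSeven_div_le_two _
    _ ≤ (1 + Real.log ((N * N : ℕ) : ℝ)) * 2 := by
        rw [← sum_mul]
        gcongr
        exact sum_one_div_le_one_add_log _
    _ = 2 * (1 + 2 * Real.log N) := by
        rw [Nat.cast_mul, ← sq, Real.log_pow]; push_cast; ring

/-- Only powers of 7 separate the two kinds of numbers; `7 / 6` is the geometric series in `1 / 7`,
obtained here by dividing the multiples of 7 by 7. -/
lemma noInertSum_le_splitSum (N : ℕ) : noInertSum N ≤ 7 / 6 * splitSum N := by
  classical
  suffices noInertSum N ≤ splitSum N + 1 / 7 * noInertSum N by linarith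
  conv_lhs => rw [noInertSum, ← sum_filter_not_add_sum_filter _ (fun n => 7 ∣ n)]
  refine add_le_add ?_ ?_
  · refine sum_le_sum_of_subset_of_nonneg (fun n hn => ?_) fun _ _ _ => by positivity
    rw [mem_filter, mem_noInert] at hn
    exact mem_filter.mpr ⟨mem_Ioc.mpr hn.1.1, hn.1.2.isSplitNumber hn.2⟩
  · have hsub : (noInert N).filter (fun n => 7 ∣ n) ⊆ (noInert N).image (fun n => 7 * n) := by
      intro n hn
      rw [mem_filter, mem_noInert] at hn
      obtain ⟨⟨⟨h1, h2⟩, h3⟩, k, rfl⟩ := hn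
      exact mem_image.mpr ⟨k, mem_noInert.mpr ⟨by omega, h3.of_dvd (dvd_mul_left k 7)⟩, rfl⟩
    refine (sum_le_sum_of_subset_of_nonneg hsub fun _ _ _ => by positivity).trans ?_
    rw [sum_image (fun a _ b _ h => by simpa using h), noInertSum, mul_sum]
    refine le_of_eq (sum_congr rfl fun n _ => ?_)
    push_cast
    rw [div_mul_div_comm, one_mul]

/-- Split `log x = log n + log (x / n)`. The second term is at most `x / n`, which adds 1 to the
constant `log 4 + 4` of Chebyshev's bound. The first is a divisor sum of the von Mangoldt function,
and cofactors of `n` again have no inert divisor. -/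
lemma log_mul_card_noInert_le {x : ℝ} (hx : 0 ≤ x) :
    Real.log x * (noInert ⌊x⌋₊).card ≤ (Real.log 4 + 5) * x * noInertSum ⌊x⌋₊ := by
  classical
  let a : ArithmeticFunction ℝ :=
    ⟨fun n => if HasNoInertDivisor n then 1 else 0, by simp [HasNoInertDivisor]⟩
  have ha : ∀ n, a n = if HasNoInertDivisor n then 1 else 0 := fun _ => rfl
  have ha0 : ∀ n, 0 ≤ a n := fun n => by rw [ha]; positivity
  have hΛ0 : ∀ n, 0 ≤ (a * ArithmeticFunction.vonMangoldt) n := fun n => by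
    rw [ArithmeticFunction.mul_apply]
    exact sum_nonneg fun x _ => mul_nonneg (ha0 _) ArithmeticFunction.vonMangoldt_nonneg
  have hlog : ∀ n, HasNoInertDivisor n →
      Real.log n ≤ (a * ArithmeticFunction.vonMangoldt) n := by
    intro n hn
    rw [← ArithmeticFunction.vonMangoldt_sum, ArithmeticFunction.mul_apply,
      ← Nat.sum_divisorsAntidiagonal' (f := fun _ d => ArithmeticFunction.vonMangoldt d)]
    refine sum_le_sum fun x hx => ?_
    have hx' := (Nat.mem_divisorsAntidiagonal.mp hx).1
    rw [ha, if_pos (hn.of_dvd ⟨x.2, hx'.symm⟩), one_mul]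
  have hsum : ∑ n ∈ noInert ⌊x⌋₊, Real.log n ≤ (Real.log 4 + 4) * x * noInertSum ⌊x⌋₊ :=
    calc ∑ n ∈ noInert ⌊x⌋₊, Real.log n
        ≤ ∑ n ∈ noInert ⌊x⌋₊, (a * ArithmeticFunction.vonMangoldt) n :=
          sum_le_sum fun n hn => hlog n (mem_noInert.mp hn).2
      _ ≤ ∑ n ∈ Ioc 0 ⌊x⌋₊, (a * ArithmeticFunction.vonMangoldt) n :=
          sum_le_sum_of_subset_of_nonneg (filter_subset _ _) fun n _ _ => hΛ0 n
      _ = ∑ n ∈ Ioc 0 ⌊x⌋₊, a n * Chebyshev.psi (x / n) := by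
          rw [ArithmeticFunction.sum_Ioc_mul_eq_sum_sum]
          refine sum_congr rfl fun n _ => ?_
          rw [Chebyshev.psi, Nat.floor_div_natCast]
      _ ≤ ∑ n ∈ Ioc 0 ⌊x⌋₊, a n * ((Real.log 4 + 4) * (x / n)) := by
          gcongr with n _
          · exact ha0 n
          · exact Chebyshev.psi_le_const_mul_self (by positivity)
      _ = (Real.log 4 + 4) * x * noInertSum ⌊x⌋₊ := by
          rw [noInertSum, noInert, sum_filter, mul_sum]
          refine sum_congr rfl fun n _ => ?_
          rw [ha]
          split_ifs
          · ring
          · simp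
  have hsplit : Real.log x * (noInert ⌊x⌋₊).card
      ≤ ∑ n ∈ noInert ⌊x⌋₊, (Real.log n + x * (1 / (n : ℝ))) := by
    rw [mul_comm, ← nsmul_eq_mul, ← sum_const]
    refine sum_le_sum fun n hn => ?_
    obtain ⟨⟨h1, h2⟩, -⟩ := mem_noInert.mp hn
    have hx0 : x ≠ 0 := by rintro rfl; simp at h2; omega
    have hn0 : (n : ℝ) ≠ 0 := by positivity
    have := Real.log_le_self (show 0 ≤ x / n by positivity)
    rw [Real.log_div hx0 hn0] at this
    rw [mul_one_div]
    linarith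
  rw [sum_add_distrib, ← mul_sum] at hsplit
  change _ ≤ _ + x * noInertSum ⌊x⌋₊ at hsplit
  linarith

/-! ### Values of the norm form -/

/-- For odd `p`, completing the square makes `-7` a square modulo `p`, and reciprocity turns this
into a condition on `p` modulo 7. -/
lemma chiSeven_ne_neg_one_of_dvd_normForm {p : ℕ} (hp : p.Prime) {m k : ℤ}
    (hmk : IsCoprime m k) (h : (p : ℤ) ∣ normForm m k) : chiSeven p ≠ -1 := by
  have := Fact.mk hp
  rcases hp.eq_two_or_odd' with rfl | hodd
  · decide
  have hsq : (2 * (m : ZMod p) + k) ^ 2 = -7 * (k : ZMod p) ^ 2 := by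
    have h0 : ((normForm m k : ℤ) : ZMod p) = 0 := (ZMod.intCast_zmod_eq_zero_iff_dvd _ p).mpr h
    unfold normForm at h0
    push_cast at h0
    linear_combination 4 * h0
  have hk : (k : ZMod p) ≠ 0 := by
    intro hk
    have hk' : (p : ℤ) ∣ k := (ZMod.intCast_zmod_eq_zero_iff_dvd _ p).mp hk
    have hm' : (p : ℤ) ∣ m ^ 2 := by
      have : m ^ 2 = normForm m k - k * (m + 2 * k) := by unfold normForm; ring
      rw [this]
      exact dvd_sub h (hk'.mul_right _)
    have hm := (Nat.prime_iff_prime_int.mp hp).dvd_of_dvd_pow hm'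
    exact (Nat.prime_iff_prime_int.mp hp).not_isUnit (hmk.isUnit_of_dvd' hm hk')
  have hJ : jacobiSym (-7) p ≠ -1 := by
    rw [← jacobiSym.legendreSym.to_jacobiSym]
    intro hneg
    rw [legendreSym.eq_neg_one_iff] at hneg
    refine hneg ⟨(2 * (m : ZMod p) + k) / k, ?_⟩
    push_cast
    field_simp
    linear_combination -hsq
  -- Reciprocity enters as periodicity modulo `28 = 4 * 7`, which leaves a finite check of odd
  -- residues.
  rw [jacobiSym.mod_right _ hodd] at hJ
  have hchi : chiSeven p = quadraticChar (ZMod 7) ((p % 28 : ℕ) : ZMod 7) := by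
    have : ((p % 28 : ℕ) : ZMod 7) = (p : ZMod 7) := by
      rw [ZMod.natCast_eq_natCast_iff]
      exact Nat.ModEq.of_dvd (by norm_num) (Nat.mod_modEq p 28)
    rw [this]; rfl
  rw [hchi]
  have hodd' : p % 28 % 2 = 1 := by have := Nat.odd_iff.mp hodd; omega
  have hlt : p % 28 < 28 := Nat.mod_lt _ (by norm_num)
  change jacobiSym (-7) (p % 28) ≠ -1 at hJ
  generalize p % 28 = r at *
  interval_cases r <;> first | omega | decide | exact absurd (by norm_num) hJ

lemma exists_sq_mul_of_normForm {v : ℕ} (hv : v ≠ 0) {m k : ℤ} (h : normForm m k = v) :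
    ∃ d w : ℕ, v = d ^ 2 * w ∧ HasNoInertDivisor w := by
  have hd : 0 < Int.gcd m k := by
    rw [Int.gcd_pos_iff]
    by_contra! h0
    rw [h0.1, h0.2] at h
    simp [normForm] at h
    exact hv (by exact_mod_cast h.symm)
  obtain ⟨m', k', hcop, hm, hk⟩ := Int.exists_gcd_one hd
  generalize Int.gcd m k = d at *
  obtain ⟨w, hw⟩ := Int.eq_ofNat_of_zero_le (normForm_nonneg m' k')
  have hvw : v = d ^ 2 * w := by
    zify
    rw [← h, ← hw, hm, hk]
    unfold normForm; ring
  refine ⟨d, w, hvw, hasNoInertDivisor_of_primes ?_ fun p hp hpw => ?_⟩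
  · rintro rfl; simp at hvw; exact hv hvw
  · refine chiSeven_ne_neg_one_of_dvd_normForm hp (Int.isCoprime_iff_gcd_eq_one.mpr hcop) ?_
    rw [hw]
    exact_mod_cast hpw

lemma card_normValues_le (N : ℕ) :
    (normValues N).card ≤ ∑ d ∈ Ioc 0 N, (noInert (N / d ^ 2)).card := by
  classical
  have hsub : normValues N ⊆
      (Ioc 0 N).biUnion fun d => (noInert (N / d ^ 2)).image fun w => d ^ 2 * w := by
    intro v hv
    obtain ⟨⟨h1, h2⟩, m, k, hmk⟩ := mem_normValues.mp hv
    obtain ⟨d, w, rfl, hw⟩ := exists_sq_mul_of_normForm (by omega) hmk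
    have hd : 0 < d := Nat.pos_of_ne_zero (by rintro rfl; simp at h1)
    have hw0 : 0 < w := Nat.pos_of_ne_zero hw.1
    refine mem_biUnion.mpr ⟨d, mem_Ioc.mpr ⟨hd, by nlinarith⟩,
      mem_image.mpr ⟨w, mem_noInert.mpr ⟨⟨hw0, ?_⟩, hw⟩, rfl⟩⟩
    rw [Nat.le_div_iff_mul_le (by positivity), mul_comm]
    exact h2
  refine (card_le_card hsub).trans (card_biUnion_le.trans (sum_le_sum fun d _ => card_image_le))

lemma exists_sum_sqrt_div_sq_le :
    ∃ K : ℝ, ∀ N : ℕ, ∑ d ∈ Ioc 0 N, √(d : ℝ) / (d : ℝ) ^ 2 ≤ K := by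
  have hs : Summable fun d : ℕ => √(d : ℝ) / (d : ℝ) ^ 2 := by
    refine (Real.summable_one_div_nat_rpow.mpr (show (1 : ℝ) < 3 / 2 by norm_num)).congr fun d => ?_
    rcases Nat.eq_zero_or_pos d with rfl | hd
    · simp
    · have hd' : (0 : ℝ) < d := by exact_mod_cast hd
      rw [Real.sqrt_eq_rpow, ← Real.rpow_natCast, ← Real.rpow_sub hd', one_div,
        ← Real.rpow_neg hd'.le]
      norm_num
  exact ⟨_, fun N => hs.sum_le_tsum _ fun d _ => by positivity⟩

/-- Here `log N = log (N / d ^ 2) + 2 * log d`, and `log d ≤ 2 * √d`; the factor `√d` lost still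
leaves a convergent sum over `d`, so no range of `d` needs separate treatment. -/
lemma card_noInert_div_sq_mul_log_le {N d : ℕ} (hN : 0 < N) (hd : 0 < d) :
    ((noInert (N / d ^ 2)).card : ℝ) * Real.log N
      ≤ √(d : ℝ) / (d : ℝ) ^ 2 * (N * ((Real.log 4 + 5) * noInertSum N + 4)) := by
  have hd1 : (1 : ℝ) ≤ d := by exact_mod_cast hd
  have hN0 : (0 : ℝ) < N := by exact_mod_cast hN
  have hsqrt : 1 ≤ √(d : ℝ) := Real.one_le_sqrt.mpr hd1
  have hl4 : 0 < Real.log 4 := Real.log_pos (by norm_num)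
  have hfloor : ⌊(N : ℝ) / (d : ℝ) ^ 2⌋₊ = N / d ^ 2 := by
    rw [← Nat.cast_pow, Nat.floor_div_eq_div]
  have h1 := log_mul_card_noInert_le (x := (N : ℝ) / (d : ℝ) ^ 2) (by positivity)
  rw [hfloor, Real.log_div hN0.ne' (by positivity), Real.log_pow] at h1
  have h2 : (Real.log 4 + 5) * ((N : ℝ) / (d : ℝ) ^ 2) * noInertSum (N / d ^ 2)
      ≤ (Real.log 4 + 5) * ((N : ℝ) / (d : ℝ) ^ 2) * noInertSum N := by
    gcongr
    exact noInertSum_mono (Nat.div_le_self _ _)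
  have h3 : ((noInert (N / d ^ 2)).card : ℝ) ≤ (N : ℝ) / (d : ℝ) ^ 2 := by
    have : ((noInert (N / d ^ 2)).card : ℝ) ≤ ((N / d ^ 2 : ℕ) : ℝ) := by
      exact_mod_cast card_noInert_le _
    refine this.trans (Nat.cast_div_le.trans (by push_cast; exact le_rfl))
  have h4 : Real.log d ≤ 2 * √(d : ℝ) := by
    have := Real.log_le_self (Real.sqrt_nonneg (d : ℝ))
    rw [Real.log_sqrt (by positivity)] at this
    linarith
  have h5 : ((noInert (N / d ^ 2)).card : ℝ) * ((2 : ℕ) * Real.log d)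
      ≤ (N : ℝ) / (d : ℝ) ^ 2 * (4 * √(d : ℝ)) := by
    refine mul_le_mul h3 (by push_cast; linarith) ?_ (by positivity)
    have := Real.log_nonneg hd1
    positivity
  have h6 : (Real.log 4 + 5) * ((N : ℝ) / (d : ℝ) ^ 2) * noInertSum N
      ≤ (Real.log 4 + 5) * ((N : ℝ) / (d : ℝ) ^ 2) * noInertSum N * √(d : ℝ) := by
    have := noInertSum_nonneg N
    exact le_mul_of_one_le_right (by positivity) hsqrt
  calc _ = (Real.log N - (2 : ℕ) * Real.log d) * ((noInert (N / d ^ 2)).card : ℝ)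
        + ((noInert (N / d ^ 2)).card : ℝ) * ((2 : ℕ) * Real.log d) := by ring
    _ ≤ (Real.log 4 + 5) * ((N : ℝ) / (d : ℝ) ^ 2) * noInertSum N * √(d : ℝ)
        + (N : ℝ) / (d : ℝ) ^ 2 * (4 * √(d : ℝ)) :=
      add_le_add (h1.trans (h2.trans h6)) h5
    _ = _ := by ring

/-- The number of values of the norm form up to `N` is `O(N / √(log N))`. -/
lemma exists_card_normValues_le :
    ∃ C : ℝ, 0 < C ∧ ∀ N : ℕ, 2 ≤ N →
      ((normValues N).card : ℝ) ≤ C * (N / √(Real.log N)) := by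
  obtain ⟨K, hK⟩ := exists_sum_sqrt_div_sq_le
  have hl4 : 0 < Real.log 4 := Real.log_pos (by norm_num)
  have hK0 : 0 < K := lt_of_lt_of_le (by simp) (hK 1)
  refine ⟨K * (4 * (Real.log 4 + 5) + 8), by positivity, fun N hN => ?_⟩
  have hlog : 1 / 2 ≤ Real.log N := by
    have h1 : Real.log 2 ≤ Real.log N := Real.log_le_log (by norm_num) (by exact_mod_cast hN)
    have := Real.log_two_gt_d9
    linarith
  have hs : √(Real.log N) ^ 2 = Real.log N := Real.sq_sqrt (by linarith)
  have hs0 : 0 ≤ √(Real.log N) := Real.sqrt_nonneg _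
  have hs1 : 1 / 2 ≤ √(Real.log N) := by nlinarith
  -- Since `log N ≥ 1 / 2`, `2 + 4 * log N ≤ 8 * log N`, below `9 * log N`.
  have hsplit : splitSum N ≤ 3 * √(Real.log N) := by
    refine abs_le_of_sq_le_sq' ?_ (by positivity) |>.2
    have := splitSum_sq_le N
    nlinarith
  have hsum : noInertSum N ≤ 4 * √(Real.log N) := by
    have := noInertSum_le_splitSum N
    linarith
  rw [← mul_div_assoc, le_div_iff₀ (by linarith)]
  suffices ((normValues N).card : ℝ) * Real.log N
      ≤ K * (4 * (Real.log 4 + 5) + 8) * N * √(Real.log N) by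
    refine le_of_mul_le_mul_right ?_ (show 0 < √(Real.log N) by linarith)
    rwa [mul_assoc, ← sq, hs]
  calc ((normValues N).card : ℝ) * Real.log N
      ≤ (∑ d ∈ Ioc 0 N, ((noInert (N / d ^ 2)).card : ℝ)) * Real.log N := by
        gcongr
        exact_mod_cast card_normValues_le N
    _ ≤ ∑ d ∈ Ioc 0 N, √(d : ℝ) / (d : ℝ) ^ 2 *
          (N * ((Real.log 4 + 5) * noInertSum N + 4)) := by
        rw [sum_mul]
        exact sum_le_sum fun d hd =>
          card_noInert_div_sq_mul_log_le (by omega) (mem_Ioc.mp hd).1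
    _ ≤ K * (N * ((Real.log 4 + 5) * (4 * √(Real.log N)) + 4 * (2 * √(Real.log N)))) := by
        rw [← sum_mul]
        have := noInertSum_nonneg N
        refine mul_le_mul (hK N) ?_ (by positivity) hK0.le
        gcongr
        linarith
    _ = _ := by ring

end

theorem mainTheorem6 :
    FourPointsThreeDistances latticeSeven ∧
    (∀ n : ℕ, ∃ P : Finset Plane, IsNearestLatticePoints n P) ∧
    (∀ (n : ℕ) (P : Finset Plane), IsNearestLatticePoints n P →
      FourPointsThreeDistances (P : Set Plane)) ∧
    (∃ C : ℝ, 0 < C ∧ ∀ (n : ℕ) (P : Finset Plane), 2 ≤ n → IsNearestLatticePoints n P →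
      ((distances (P : Set Plane)).ncard : ℝ) ≤ C * ((n : ℝ) / Real.sqrt (Real.log n))) := by
  refine ⟨fourPointsThreeDistances_latticeSeven, exists_isNearestLatticePoints,
    fun n P hP => fourPointsThreeDistances_latticeSeven.mono hP.1, ?_⟩
  obtain ⟨C, hC, hbound⟩ := exists_card_normValues_le
  refine ⟨16 * C, by positivity, fun n P hn hP => ?_⟩
  have hn' : (2 : ℝ) ≤ n := by exact_mod_cast hn
  have hlog : 0 < Real.log n := Real.log_pos (by linarith)
  calc ((distances (P : Set Plane)).ncard : ℝ) ≤ (normValues (16 * n)).card := by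
        exact_mod_cast hP.ncard_distances_le
    _ ≤ C * ((16 * n : ℕ) / √(Real.log (16 * n : ℕ))) := hbound _ (by omega)
    _ ≤ C * ((16 * n : ℕ) / √(Real.log n)) := by
        gcongr
        linarith
    _ = 16 * C * (n / √(Real.log n)) := by push_cast; ring
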